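/- Let $A$ be a ring and $N$ an $A$-$A$-bimodule, and let $$\Lambda_{(0,0)}=\begin{pmatrix} A & N\\ N & A\end{pmatrix}$$ be the Morita ring with zero bimodule homomorphisms: its elements are the matrices $\begin{pmatrix} a & n\\ m & b\end{pmatrix}$ with $a,b\in A$ and $n,m\in N$, addition is componentwise, and $$\begin{pmatrix} a & n\\ m & b\end{pmatrix}\begin{pmatrix} a' & n'\\ m' & b'\end{pmatrix}=\begin{pmatrix} aa' & an'+nb'\\ ma'+bm' & bb'\end{pmatrix}.$$ Suppose that $\Lambda_{(0,0)}$ is an Artin algebra, i.e. an algebra over a commutative artinian ring $R$ that is finitely generated as an $R$-module. Assume that 1. $N$ is projective as a left $A$-module and as a right $A$-module, and 2. $N\otimes_A N=0$. Call an Artin algebra $\Lambda$ Gorenstein if $\Lambda$ has finite injective dimension both as a left and as a right $\Lambda$-module. If $A$ is Gorenstein, then $\Lambda_{(0,0)}$ is Gorenstein. Moreover, if $\operatorname{gl.dim} A<\infty$, then $\operatorname{gl.dim}\Lambda_{(0,0)}<\infty$, where $\operatorname{gl.dim}$ denotes the (left) global dimension. -/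

import Mathlib

open CategoryTheory MulOpposite
open scoped TensorProduct

universe u w

/-- The underlying set of the Morita ring with zero bimodule homomorphisms: the `2 × 2` matrices
`(a n; m b)` with `a ∈ A`, `n ∈ N`, `m ∈ M`, `b ∈ B`. -/
@[ext]
structure ZeroMoritaRing (A B N M : Type*) where
  a : A
  n : N
  m : M
  b : B

namespace ZeroMoritaRing

section AddGroup

variable {A B N M : Type*} [Ring A] [Ring B] [AddCommGroup N] [AddCommGroup M]

instance : Zero (ZeroMoritaRing A B N M) := ⟨⟨0, 0, 0, 0⟩⟩
instance : Add (ZeroMoritaRing A B N M) :=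
  ⟨fun x y => ⟨x.a + y.a, x.n + y.n, x.m + y.m, x.b + y.b⟩⟩
instance : Neg (ZeroMoritaRing A B N M) := ⟨fun x => ⟨-x.a, -x.n, -x.m, -x.b⟩⟩
instance : One (ZeroMoritaRing A B N M) := ⟨⟨1, 0, 0, 1⟩⟩

@[simp] theorem zero_a : (0 : ZeroMoritaRing A B N M).a = 0 := rfl
@[simp] theorem zero_n : (0 : ZeroMoritaRing A B N M).n = 0 := rfl
@[simp] theorem zero_m : (0 : ZeroMoritaRing A B N M).m = 0 := rfl
@[simp] theorem zero_b : (0 : ZeroMoritaRing A B N M).b = 0 := rfl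
@[simp] theorem one_a : (1 : ZeroMoritaRing A B N M).a = 1 := rfl
@[simp] theorem one_n : (1 : ZeroMoritaRing A B N M).n = 0 := rfl
@[simp] theorem one_m : (1 : ZeroMoritaRing A B N M).m = 0 := rfl
@[simp] theorem one_b : (1 : ZeroMoritaRing A B N M).b = 1 := rfl
@[simp] theorem add_a (x y : ZeroMoritaRing A B N M) : (x + y).a = x.a + y.a := rfl
@[simp] theorem add_n (x y : ZeroMoritaRing A B N M) : (x + y).n = x.n + y.n := rfl
@[simp] theorem add_m (x y : ZeroMoritaRing A B N M) : (x + y).m = x.m + y.m := rfl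
@[simp] theorem add_b (x y : ZeroMoritaRing A B N M) : (x + y).b = x.b + y.b := rfl
@[simp] theorem neg_a (x : ZeroMoritaRing A B N M) : (-x).a = -x.a := rfl
@[simp] theorem neg_n (x : ZeroMoritaRing A B N M) : (-x).n = -x.n := rfl
@[simp] theorem neg_m (x : ZeroMoritaRing A B N M) : (-x).m = -x.m := rfl
@[simp] theorem neg_b (x : ZeroMoritaRing A B N M) : (-x).b = -x.b := rfl

end AddGroup

section Ring

/- `N` is an `A`-`B`-bimodule and `M` is a `B`-`A`-bimodule; a right module over a ring is a module
over the opposite ring, so `op b • n` is `n b`. -/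
variable {A B N M : Type*} [Ring A] [Ring B] [AddCommGroup N] [AddCommGroup M]
  [Module A N] [Module Bᵐᵒᵖ N] [Module B M] [Module Aᵐᵒᵖ M]

/-- `(a n; m b) (a' n'; m' b') = (aa'  an' + nb'; ma' + bm'  bb')`. -/
instance : Mul (ZeroMoritaRing A B N M) :=
  ⟨fun x y => ⟨x.a * y.a, x.a • y.n + op y.b • x.n, op y.a • x.m + x.b • y.m, x.b * y.b⟩⟩

@[simp] theorem mul_a (x y : ZeroMoritaRing A B N M) : (x * y).a = x.a * y.a := rfl
@[simp] theorem mul_n (x y : ZeroMoritaRing A B N M) :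
    (x * y).n = x.a • y.n + op y.b • x.n := rfl
@[simp] theorem mul_m (x y : ZeroMoritaRing A B N M) :
    (x * y).m = op y.a • x.m + x.b • y.m := rfl
@[simp] theorem mul_b (x y : ZeroMoritaRing A B N M) : (x * y).b = x.b * y.b := rfl

variable [SMulCommClass A Bᵐᵒᵖ N] [SMulCommClass B Aᵐᵒᵖ M]

/-- The Morita ring `Λ₍₀,₀₎ = (A N; M B)` with zero bimodule homomorphisms. -/
instance : Ring (ZeroMoritaRing A B N M) where
  add_assoc x y z := by ext <;> simp [add_assoc]
  zero_add x := by ext <;> simp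
  add_zero x := by ext <;> simp
  add_comm x y := by ext <;> simp [add_comm]
  neg_add_cancel x := by ext <;> simp
  nsmul := nsmulRec
  zsmul := zsmulRec
  left_distrib x y z := by ext <;> simp [mul_add, smul_add, add_smul] <;> abel
  right_distrib x y z := by ext <;> simp [add_mul, smul_add, add_smul] <;> abel
  zero_mul x := by ext <;> simp
  mul_zero x := by ext <;> simp
  one_mul x := by ext <;> simp
  mul_one x := by ext <;> simp
  mul_assoc x y z := by
    ext <;> simp [mul_assoc, smul_add, mul_smul, add_assoc, smul_comm]

end Ring

end ZeroMoritaRing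

/-- The tensor product `M ⊗_A N` of a right module `M` and a left module `N` over a (possibly
noncommutative) ring `A`: the quotient of `M ⊗_ℤ N` by the subgroup generated by the elements
`m a ⊗ n - m ⊗ a n`. -/
abbrev BalancedTensor (A : Type*) [Ring A] (M N : Type*) [AddCommGroup M] [AddCommGroup N]
    [Module Aᵐᵒᵖ M] [Module A N] : Type _ :=
  (M ⊗[ℤ] N) ⧸ AddSubgroup.closure
    {t : M ⊗[ℤ] N | ∃ (m : M) (a : A) (n : N), t = (op a • m) ⊗ₜ[ℤ] n - m ⊗ₜ[ℤ] (a • n)}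

/-- A ring is Gorenstein (used for Artin algebras) if it has finite injective dimension both as a
left and as a right module over itself. -/
def IsGorensteinRing (Λ : Type u) [Ring Λ] : Prop :=
  injectiveDimension (ModuleCat.of Λ Λ) < ⊤ ∧ injectiveDimension (ModuleCat.of Λᵐᵒᵖ Λ) < ⊤

/-- The (left) global dimension of a ring: the supremum of the projective dimensions of its left
modules. It is `⊥` exactly for the zero ring. -/
noncomputable def leftGlobalDimension (Λ : Type u) [Ring Λ] : WithBot ℕ∞ :=
  ⨆ X : ModuleCat.{u} Λ, projectiveDimension X

/-! The proof works with injective dimensions throughout. Write `Λ` for the Morita ring. Since the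
bimodule homomorphisms are zero, both diagonal projections `Λ → A` are ring homomorphisms, and an
`A`-module `X` gives two `Λ`-modules `(X, 0)` and `(0, X)`. The heart of the matter is the estimate
`id_Λ (X, 0) ≤ id_A X + 1` (`ZeroMoritaRing.hasInjectiveDimensionLE_of_fstHom`) and its mirror image.
By dimension shifting it suffices to treat an injective `A`-module `J`, for which there is an exact
sequence
`0 → (J, 0) → (J, Hom_A(N, J)) → (0, Hom_A(N, J)) → 0`.
The middle term is coinduced from `J` along an idempotent, hence injective
(`ZeroMoritaRing.Coinduced.injective`). In the last term, `Z = Hom_A(N, J)` is an injective `A`-module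
because `N` is flat on the right (`HomDual.injective`), and
`Hom_A(N, Z) = Hom_A(N ⊗_A N, J) = 0`, so that `(0, Z)` is itself the module coinduced from `Z` along
the other idempotent, hence injective.

For the Gorenstein property, the left module `Λ` is filtered with layers `A`, `A`, `N`, `N`, and
`id_A N ≤ id_A A` because `N` is projective on the left and finitely generated, the latter because
`Λ` is an Artin algebra. The right module is handled by the same statement for the opposite ring,
which is the Morita ring of `N` over `Aᵐᵒᵖ` (`ZeroMoritaRing.opEquiv`).

For the global dimension, every `Λ`-module has a filtration with three layers of the form `(X, 0)` or
`(0, X)` (`ZeroMoritaRing.hasInjectiveDimensionLE_of_forall`), and finiteness of the global dimension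
amounts to a common bound on the injective dimensions of all modules
(`leftGlobalDimension_lt_top_iff`). -/

/-! ### The dual of a bimodule -/

/-- `Hom_A(N, J)` for an `A`-`A`-bimodule `N` and a left `A`-module `J`, regarded as a left
`A`-module through the right action on `N`: `(a φ)(n) = φ(n a)`. It is a type synonym, so that this
action cannot be confused with the pointwise one available when `A` is commutative. -/
def HomDual (A N J : Type*) [Ring A] [AddCommGroup N] [AddCommGroup J] [Module A N]
    [Module A J] : Type _ := N →ₗ[A] J

namespace HomDual

variable {A N J : Type*} [Ring A] [AddCommGroup N] [AddCommGroup J] [Module A N] [Module A J]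

instance : AddCommGroup (HomDual A N J) := inferInstanceAs (AddCommGroup (N →ₗ[A] J))

instance : FunLike (HomDual A N J) N J := inferInstanceAs (FunLike (N →ₗ[A] J) N J)

instance : LinearMapClass (HomDual A N J) A N J :=
  inferInstanceAs (LinearMapClass (N →ₗ[A] J) A N J)

/-- The element of `HomDual A N J` given by a linear map. -/
def ofLinearMap (f : N →ₗ[A] J) : HomDual A N J := f

/-- The linear map underlying an element of `HomDual A N J`. -/
def toLinearMap (φ : HomDual A N J) : N →ₗ[A] J := φ

@[simp] theorem ofLinearMap_apply (f : N →ₗ[A] J) (n : N) : ofLinearMap f n = f n := rfl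
@[simp] theorem toLinearMap_apply (φ : HomDual A N J) (n : N) : φ.toLinearMap n = φ n := rfl

@[ext] theorem ext {φ ψ : HomDual A N J} (h : ∀ n, φ n = ψ n) : φ = ψ := DFunLike.ext _ _ h

@[simp] theorem add_apply (φ ψ : HomDual A N J) (n : N) : (φ + ψ) n = φ n + ψ n := rfl
@[simp] theorem zero_apply (n : N) : (0 : HomDual A N J) n = 0 := rfl

/-- Evaluation at an element of `N`. -/
def evalHom (n : N) : HomDual A N J →+ J where
  toFun φ := φ n
  map_zero' := rfl
  map_add' _ _ := rfl

@[simp] theorem evalHom_apply (n : N) (φ : HomDual A N J) : evalHom n φ = φ n := rfl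

variable [Module Aᵐᵒᵖ N] [SMulCommClass A Aᵐᵒᵖ N]

instance : SMul A (HomDual A N J) where
  smul a φ := ofLinearMap
    { toFun := fun n => φ (op a • n)
      map_add' := fun x y => by rw [smul_add, map_add]
      map_smul' := fun c x => by rw [← smul_comm, map_smul, RingHom.id_apply] }

@[simp] theorem smul_apply (a : A) (φ : HomDual A N J) (n : N) : (a • φ) n = φ (op a • n) := rfl

instance : Module A (HomDual A N J) where
  one_smul φ := by ext; simp
  mul_smul a b φ := by ext; simp [mul_smul]
  smul_zero a := by ext; simp
  smul_add a φ ψ := by ext; simp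
  add_smul a b φ := by ext; simp [add_smul]
  zero_smul φ := by ext; simp

end HomDual

theorem Module.Injective.exists_comp_eq_of_ker_le {A D N J : Type u} [Ring A] [AddCommGroup D]
    [AddCommGroup N] [AddCommGroup J] [Module A D] [Module A N] [Module A J]
    [Module.Injective A J] (p : D →ₗ[A] N) (q : D →ₗ[A] J)
    (h : LinearMap.ker p ≤ LinearMap.ker q) : ∃ f : N →ₗ[A] J, ∀ d, f (p d) = q d := by
  obtain ⟨f, hf⟩ := Module.Injective.out ((LinearMap.ker p).liftQ p le_rfl)
    (LinearMap.ker_eq_bot.1 (Submodule.ker_liftQ_eq_bot _ _ _ le_rfl))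
    ((LinearMap.ker p).liftQ q h)
  exact ⟨f, fun d => by simpa using hf (Submodule.Quotient.mk d)⟩

/-- A homomorphism `φ` from a left ideal `L` to `Hom_A(N, J)` amounts to a balanced map
`(n, l) ↦ φ l n`, and one has to see that it factors through the multiplication `(n, l) ↦ n l`
with values in `N`. This is the injectivity of `N ⊗_A L → N`, which a dual basis of the right module
`N` makes explicit. -/
theorem HomDual.injective {A N J : Type u} [Ring A] [AddCommGroup N] [AddCommGroup J] [Module A N]
    [Module A J] [Module Aᵐᵒᵖ N] [SMulCommClass A Aᵐᵒᵖ N] [Module.Projective Aᵐᵒᵖ N]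
    [Module.Injective A J] : Module.Injective A (HomDual A N J) := by
  refine Module.Baer.injective fun L φ => ?_
  obtain ⟨s, hs⟩ := Module.projective_def'.1 ‹Module.Projective Aᵐᵒᵖ N›
  -- `p` and `q` are the maps `Σ n ⊗ l ↦ Σ n l` and `Σ n ⊗ l ↦ Σ φ l n`, on formal sums.
  let p : (L →₀ N) →ₗ[A] N := Finsupp.lsum ℕ fun l : L =>
    { toFun := fun n => op (l : A) • n
      map_add' := fun x y => smul_add _ _ _
      map_smul' := fun c x => (smul_comm _ _ _).symm }
  let q : (L →₀ N) →ₗ[A] J := Finsupp.lsum ℕ fun l : L => (φ l).toLinearMap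
  -- `t` applies the dual basis to `N`; its values determine those of `q`.
  let t : (L →₀ N) →+ (N →₀ L) := Finsupp.liftAddHom fun l =>
    (Finsupp.mapRange.addMonoidHom
      { toFun := fun c : Aᵐᵒᵖ => unop c • l
        map_zero' := by simp
        map_add' := fun x y => by simp [add_smul] }).comp s.toAddMonoidHom
  let r : (N →₀ L) →+ J := Finsupp.liftAddHom fun n =>
    (HomDual.evalHom n).comp φ.toAddMonoidHom
  have hp : ∀ l n, p (Finsupp.single l n) = op (l : A) • n := fun l n => by simp [p]
  have hq : ∀ l n, q (Finsupp.single l n) = φ l n := fun l n => by simp [q]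
  have hrt : r.comp t = q.toAddMonoidHom := by
    ext l n
    have h1 : φ l (Finsupp.linearCombination Aᵐᵒᵖ id (s n)) = φ l n :=
      congrArg _ (DFunLike.congr_fun hs n)
    simp only [AddMonoidHom.comp_apply, LinearMap.toAddMonoidHom_coe,
      Finsupp.singleAddHom_apply, hq, ← h1]
    have h2 : t (Finsupp.single l n) = Finsupp.mapRange (fun c : Aᵐᵒᵖ => unop c • l)
        (by simp) (s n) := by
      simp [t]
    rw [h2, Finsupp.linearCombination_apply, map_finsuppSum, Finsupp.liftAddHom_apply,
      Finsupp.sum_mapRange_index (by simp)]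
    refine Finsupp.sum_congr fun x _ => ?_
    simp
  have hts : ∀ d x, ((t d x : L) : A) = unop (s (p d) x) := by
    intro d x
    induction d using Finsupp.induction_linear with
    | zero => simp
    | add d e hd he => simp [hd, he]
    | single l n => simp [t, hp]
  obtain ⟨f, hf⟩ := Module.Injective.exists_comp_eq_of_ker_le p q fun d hd => by
    have h0 : t d = 0 := by
      ext x
      rw [hts, LinearMap.mem_ker.1 hd]; simp
    have h1 := DFunLike.congr_fun hrt d
    simpa [h0] using h1.symm
  refine ⟨LinearMap.toSpanSingleton A (HomDual A N J) (HomDual.ofLinearMap f), fun l hl => ?_⟩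
  ext n
  have := hf (Finsupp.single ⟨l, hl⟩ n)
  rw [hp, hq] at this
  rw [LinearMap.toSpanSingleton_apply, HomDual.smul_apply]
  exact this

/-! ### Coinduced modules over the Morita ring -/

namespace ZeroMoritaRing

/-- The left module `(J, Hom_A(N, J))` over the Morita ring, coinduced from the left `A`-module `J`
along the idempotent `(1 0; 0 0)`: in column notation,
`(a n; m b) (j, φ) = (a j + φ(n), φ(- b))`. -/
def Coinduced (A N J : Type*) [Ring A] [AddCommGroup N] [AddCommGroup J] [Module A N]
    [Module A J] : Type _ := J × HomDual A N J

section Coinduced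

variable {A N J : Type*} [Ring A] [AddCommGroup N] [AddCommGroup J] [Module A N] [Module A J]

instance : AddCommGroup (Coinduced A N J) := inferInstanceAs (AddCommGroup (J × HomDual A N J))

@[ext] theorem Coinduced.ext {x y : Coinduced A N J} (h₁ : x.1 = y.1) (h₂ : x.2 = y.2) : x = y :=
  Prod.ext h₁ h₂

@[simp] theorem Coinduced.add_fst (x y : Coinduced A N J) : (x + y).1 = x.1 + y.1 := rfl
@[simp] theorem Coinduced.add_snd (x y : Coinduced A N J) : (x + y).2 = x.2 + y.2 := rfl
@[simp] theorem Coinduced.zero_fst : (0 : Coinduced A N J).1 = 0 := rfl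
@[simp] theorem Coinduced.zero_snd : (0 : Coinduced A N J).2 = 0 := rfl

/-- The element of the coinduced module with the given components. -/
def Coinduced.mk (j : J) (φ : HomDual A N J) : Coinduced A N J := (j, φ)

@[simp] theorem Coinduced.mk_fst (j : J) (φ : HomDual A N J) : (Coinduced.mk j φ).1 = j := rfl
@[simp] theorem Coinduced.mk_snd (j : J) (φ : HomDual A N J) : (Coinduced.mk j φ).2 = φ := rfl

variable [Module Aᵐᵒᵖ N] [SMulCommClass A Aᵐᵒᵖ N]

instance : SMul (ZeroMoritaRing A A N N) (Coinduced A N J) where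
  smul r x := Coinduced.mk (r.a • x.1 + x.2 r.n) (r.b • x.2)

@[simp] theorem Coinduced.smul_fst (r : ZeroMoritaRing A A N N) (x : Coinduced A N J) :
    (r • x).1 = r.a • x.1 + x.2 r.n := rfl
@[simp] theorem Coinduced.smul_snd (r : ZeroMoritaRing A A N N) (x : Coinduced A N J) :
    (r • x).2 = r.b • x.2 := rfl

instance : Module (ZeroMoritaRing A A N N) (Coinduced A N J) where
  one_smul x := by ext <;> simp
  mul_smul r s x := by ext <;> simp [mul_smul, add_assoc]
  smul_zero r := by ext <;> simp
  smul_add r x y := by ext <;> simp [add_add_add_comm]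
  add_smul r s x := by ext <;> simp [add_smul, add_add_add_comm]
  zero_smul x := by ext <;> simp

end Coinduced

section Projections

variable (A B N M : Type*) [Ring A] [Ring B] [AddCommGroup N] [AddCommGroup M]
  [Module A N] [Module Bᵐᵒᵖ N] [Module B M] [Module Aᵐᵒᵖ M]
  [SMulCommClass A Bᵐᵒᵖ N] [SMulCommClass B Aᵐᵒᵖ M]

/-- The projection `(a n; m b) ↦ a`, multiplicative since the bimodule homomorphisms are zero. -/
def fstHom : ZeroMoritaRing A B N M →+* A where
  toFun := a
  map_one' := rfl
  map_mul' _ _ := rfl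
  map_zero' := rfl
  map_add' _ _ := rfl

/-- The projection `(a n; m b) ↦ b`. -/
def sndHom : ZeroMoritaRing A B N M →+* B where
  toFun := b
  map_one' := rfl
  map_mul' _ _ := rfl
  map_zero' := rfl
  map_add' _ _ := rfl

/-- The isomorphism `(a n; m b) ↦ (b m; n a)`. -/
def swap : ZeroMoritaRing A B N M ≃+* ZeroMoritaRing B A M N where
  toFun r := ⟨r.b, r.m, r.n, r.a⟩
  invFun r := ⟨r.b, r.m, r.n, r.a⟩
  left_inv _ := rfl
  right_inv _ := rfl
  map_mul' r s := by ext <;> simp [add_comm]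
  map_add' _ _ := rfl

end Projections

section Diagonal

variable (A N : Type*) [Ring A] [AddCommGroup N] [Module A N] [Module Aᵐᵒᵖ N]
  [SMulCommClass A Aᵐᵒᵖ N]

/-- The diagonal embedding `a ↦ (a 0; 0 a)`. -/
def diagHom : A →+* ZeroMoritaRing A A N N where
  toFun a := ⟨a, 0, 0, a⟩
  map_one' := rfl
  map_mul' a b := by ext <;> simp
  map_zero' := rfl
  map_add' a b := by ext <;> simp

end Diagonal

section

variable {A N : Type u} [Ring A] [AddCommGroup N] [Module A N] [Module Aᵐᵒᵖ N]
  [SMulCommClass A Aᵐᵒᵖ N]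

local notation "Λ" => ZeroMoritaRing A A N N

@[simp] theorem fstHom_apply (r : Λ) : fstHom A A N N r = r.a := rfl
@[simp] theorem sndHom_apply (r : Λ) : sndHom A A N N r = r.b := rfl

theorem Coinduced.injective (J : Type u) [AddCommGroup J] [Module A J] [Module.Injective A J] :
    Module.Injective Λ (Coinduced A N J) where
  out X Y _ _ _ _ i hi g := by
    let := Module.compHom X (diagHom A N)
    let := Module.compHom Y (diagHom A N)
    have hX : ∀ (a : A) (x : X), a • x = (⟨a, 0, 0, a⟩ : Λ) • x := fun _ _ => rfl
    have hY : ∀ (a : A) (y : Y), a • y = (⟨a, 0, 0, a⟩ : Λ) • y := fun _ _ => rfl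
    let i' : X →ₗ[A] Y :=
      { toFun := i, map_add' := i.map_add, map_smul' := fun a x => i.map_smul (⟨a, 0, 0, a⟩ : Λ) x }
    let g' : X →ₗ[A] J :=
      { toFun := fun x => (g x).1
        map_add' := fun x y => by simp
        map_smul' := fun a x => by simp [hX] }
    obtain ⟨h, hh⟩ := Module.Injective.out i' hi g'
    -- A homomorphism to the coinduced module is determined by the `A`-linear map it induces
    -- on the first component.
    let φ : Y → HomDual A N J := fun y => HomDual.ofLinearMap
      { toFun := fun n => h ((⟨0, n, 0, 0⟩ : Λ) • y)
        map_add' := fun n n' => by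
          rw [← map_add, ← add_smul]; congr 2; ext <;> simp
        map_smul' := fun a n => by
          rw [RingHom.id_apply, ← map_smul, hY, ← mul_smul]; congr 2; ext <;> simp }
    have hφ : ∀ y n, φ y n = h ((⟨0, n, 0, 0⟩ : Λ) • y) := fun _ _ => rfl
    let k : Y → Coinduced A N J := fun y => Coinduced.mk (h ((⟨1, 0, 0, 0⟩ : Λ) • y)) (φ y)
    have hk₁ : ∀ y, (k y).1 = h ((⟨1, 0, 0, 0⟩ : Λ) • y) := fun _ => rfl
    have hk₂ : ∀ y n, (k y).2 n = h ((⟨0, n, 0, 0⟩ : Λ) • y) := fun _ _ => rfl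
    have hh' : ∀ x, h (i x) = (g x).1 := hh
    refine ⟨{ toFun := k, map_add' := fun x y => ?_, map_smul' := fun r y => ?_ }, fun x => ?_⟩
    · refine Coinduced.ext ?_ (HomDual.ext fun n => ?_)
      · simp [hk₁]
      · simp [hk₂]
    · refine Coinduced.ext ?_ (HomDual.ext fun n => ?_)
      · simp only [RingHom.id_apply, Coinduced.smul_fst, hk₁, hk₂]
        rw [← map_smul, ← map_add, hY, ← mul_smul, ← mul_smul, ← add_smul]
        congr 2; ext <;> simp
      · simp only [RingHom.id_apply, Coinduced.smul_snd, hk₂, HomDual.smul_apply]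
        rw [← mul_smul]
        congr 2; ext <;> simp
    · refine Coinduced.ext ?_ (HomDual.ext fun n => ?_)
      · change (k (i x)).1 = _
        rw [hk₁, ← map_smul, hh']; simp
      · change (k (i x)).2 n = _
        rw [hk₂, ← map_smul, hh']; simp

end

end ZeroMoritaRing

/-! ### Injective dimension in short exact sequences -/

section InjectiveDimension

variable {R M₁ M₂ M₃ : Type u} [Ring R] [AddCommGroup M₁] [AddCommGroup M₂] [AddCommGroup M₃]
  [Module R M₁] [Module R M₂] [Module R M₃]

theorem hasInjectiveDimensionLE_of_surjective {n : ℕ} (g : M₂ →ₗ[R] M₃)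
    (hg : Function.Surjective g)
    (h₁ : HasInjectiveDimensionLE (ModuleCat.of R (LinearMap.ker g)) n)
    (h₃ : HasInjectiveDimensionLE (ModuleCat.of R M₃) n) :
    HasInjectiveDimensionLE (ModuleCat.of R M₂) n :=
  ShortComplex.ShortExact.hasInjectiveDimensionLT_X₂
    (S := ModuleCat.shortComplexOfCompEqZero (LinearMap.ker g).subtype g
      (LinearMap.exact_subtype_ker_map g).linearMap_comp_eq_zero)
    (ModuleCat.shortComplex_shortExact _ (LinearMap.exact_subtype_ker_map g)
      (Submodule.subtype_injective _) hg) _ h₁ h₃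

theorem hasInjectiveDimensionLE_of_submodule {n : ℕ} (P : Submodule R M₂)
    (h₁ : HasInjectiveDimensionLE (ModuleCat.of R P) n)
    (h₃ : HasInjectiveDimensionLE (ModuleCat.of R (M₂ ⧸ P)) n) :
    HasInjectiveDimensionLE (ModuleCat.of R M₂) n :=
  ShortComplex.ShortExact.hasInjectiveDimensionLT_X₂
    (S := ModuleCat.shortComplexOfCompEqZero P.subtype P.mkQ
      (LinearMap.exact_subtype_mkQ P).linearMap_comp_eq_zero)
    (ModuleCat.shortComplex_shortExact _ (LinearMap.exact_subtype_mkQ P)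
      (Submodule.subtype_injective _) P.mkQ_surjective) _ h₁ h₃

theorem hasInjectiveDimensionLE_of_subsingleton [Subsingleton M₁] (n : ℕ) :
    HasInjectiveDimensionLE (ModuleCat.of R M₁) n := by
  have := (ModuleCat.isZero_of_subsingleton (ModuleCat.of R M₁)).hasInjectiveDimensionLT_zero
  exact hasInjectiveDimensionLT_of_ge _ 0 _ (Nat.zero_le _)

theorem hasInjectiveDimensionLE_succ_of_exact {n : ℕ} (f : M₁ →ₗ[R] M₂) (g : M₂ →ₗ[R] M₃)
    (hf : Function.Injective f) (hfg : Function.Exact f g) (hg : Function.Surjective g)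
    (h₂ : HasInjectiveDimensionLE (ModuleCat.of R M₂) (n + 1))
    (h₃ : HasInjectiveDimensionLE (ModuleCat.of R M₃) n) :
    HasInjectiveDimensionLE (ModuleCat.of R M₁) (n + 1) :=
  ShortComplex.ShortExact.hasInjectiveDimensionLT_X₁
    (S := ModuleCat.shortComplexOfCompEqZero f g hfg.linearMap_comp_eq_zero)
    (ModuleCat.shortComplex_shortExact _ hfg hf hg) (n + 1) h₃ h₂

theorem Module.Injective.hasInjectiveDimensionLE (h : Module.Injective R M₁) (n : ℕ) :
    HasInjectiveDimensionLE (ModuleCat.of R M₁) n := by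
  have := Module.injective_object_of_injective_module R M₁
  exact hasInjectiveDimensionLT_of_ge _ 1 _ (by omega)

theorem hasInjectiveDimensionLE_pi {n : ℕ} (h : HasInjectiveDimensionLE (ModuleCat.of R M₁) n)
    (k : ℕ) : HasInjectiveDimensionLE (ModuleCat.of R (Fin k → M₁)) n := by
  induction k with
  | zero => exact hasInjectiveDimensionLE_of_subsingleton n
  | succ k ih =>
    refine hasInjectiveDimensionLE_of_surjective (LinearMap.proj (R := R) (φ := fun _ => M₁) 0)
      (Function.surjective_eval 0) ?_ h
    let e : (Fin k → M₁) ≃ₗ[R]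
        LinearMap.ker (LinearMap.proj (R := R) (φ := fun _ : Fin (k + 1) => M₁) 0) :=
      { toFun := fun x => ⟨Fin.cons 0 x, by simp⟩
        invFun := fun x => Fin.tail x.1
        map_add' := fun x y => by ext i; refine Fin.cases ?_ (fun i => ?_) i <;> simp
        map_smul' := fun r x => by ext i; refine Fin.cases ?_ (fun i => ?_) i <;> simp
        left_inv := fun x => by simp
        right_inv := fun x => by
          ext i
          have : x.1 0 = 0 := x.2
          refine Fin.cases ?_ (fun i => ?_) i <;> simp [Fin.tail, this] }
    exact hasInjectiveDimensionLT_of_iso e.toModuleIso _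

theorem hasInjectiveDimensionLE_of_finite_projective {n : ℕ}
    (h : HasInjectiveDimensionLE (ModuleCat.of R R) n) [Module.Finite R M₁]
    [Module.Projective R M₁] : HasInjectiveDimensionLE (ModuleCat.of R M₁) n := by
  obtain ⟨k, f, g, -, -, hfg⟩ := Module.Finite.exists_comp_eq_id_of_projective R M₁
  have := hasInjectiveDimensionLE_pi h k
  exact Retract.hasInjectiveDimensionLT (Y := ModuleCat.of R (Fin k → R))
    { i := ModuleCat.ofHom g
      r := ModuleCat.ofHom f
      retract := by rw [← ModuleCat.ofHom_comp, hfg]; rfl } _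

end InjectiveDimension

/-! ### Vanishing of `N ⊗_A N` -/

/-- The vanishing of `N ⊗_A N`, expressed by the universal property: a biadditive map on `N × N`
that is balanced over `A` is zero. -/
def BalancedMapsVanish (A N : Type u) [Ring A] [AddCommGroup N] [Module A N]
    [Module Aᵐᵒᵖ N] : Prop :=
  ∀ (P : Type u) [AddCommGroup P] (β : N →+ N →+ P),
    (∀ (a : A) (x y : N), β (op a • x) y = β x (a • y)) → ∀ x y, β x y = 0

theorem balancedMapsVanish_of_subsingleton {A N : Type u} [Ring A] [AddCommGroup N] [Module A N]
    [Module Aᵐᵒᵖ N] (h : Subsingleton (BalancedTensor A N N)) : BalancedMapsVanish A N := by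
  intro P _ β hβ x y
  let f : N ⊗[ℤ] N →+ P := TensorProduct.liftAddHom β fun r m n => by simp
  have hf : x ⊗ₜ[ℤ] y ∈ AddSubgroup.closure {t : N ⊗[ℤ] N | ∃ (m : N) (a : A) (n : N),
      t = (op a • m) ⊗ₜ[ℤ] n - m ⊗ₜ[ℤ] (a • n)} := by
    rw [← QuotientAddGroup.eq_zero_iff]
    exact Subsingleton.elim _ _
  have hle : AddSubgroup.closure {t : N ⊗[ℤ] N | ∃ (m : N) (a : A) (n : N),
      t = (op a • m) ⊗ₜ[ℤ] n - m ⊗ₜ[ℤ] (a • n)} ≤ f.ker := by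
    rw [AddSubgroup.closure_le]
    rintro _ ⟨m, a, n, rfl⟩
    simp [f, AddMonoidHom.mem_ker, hβ]
  simpa [f] using hle hf

/-- `Hom_A(N, Hom_A(N, J)) = Hom_A(N ⊗_A N, J)`. -/
theorem HomDual.eq_zero_of_balancedMapsVanish {A N J : Type u} [Ring A] [AddCommGroup N]
    [Module A N] [Module Aᵐᵒᵖ N] [AddCommGroup J]
    [Module A J] [SMulCommClass A Aᵐᵒᵖ N] 
    (hN : BalancedMapsVanish A N) (ψ : HomDual A N (HomDual A N J)) : ψ = 0 := by
  ext x y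
  let β : N →+ N →+ J := AddMonoidHom.mk' (fun y => AddMonoidHom.mk' (fun x => ψ x y)
    fun x x' => by simp) fun y y' => by ext x; simp
  exact hN J β (fun a y x => by simp [β]) y x

/-! ### Modules inflated along the diagonal projections -/

namespace ZeroMoritaRing

variable {A N : Type u} [Ring A] [AddCommGroup N] [Module A N] [Module Aᵐᵒᵖ N]
  [SMulCommClass A Aᵐᵒᵖ N]

local notation "Λ" => ZeroMoritaRing A A N N

attribute [local instance] RingHomInvPair.of_ringEquiv

/-- If `Hom_A(N, J) = 0`, then `(0, J)` is the mirror image of the module coinduced from `J`. -/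
theorem injective_of_sndHom {J Q : Type u} [AddCommGroup J] [Module A J] [Module.Injective A J]
    (hJ : ∀ ψ : HomDual A N J, ψ = 0) [AddCommGroup Q] [Module Λ Q]
    (f : Q →ₛₗ[sndHom A A N N] J) (hf : Function.Bijective f) : Module.Injective Λ Q := by
  have := Coinduced.injective (A := A) (N := N) J
  let f' : Q ≃+ J := AddEquiv.ofBijective f.toAddMonoidHom hf
  have hf' : ∀ x, f (f'.symm x) = x := f'.apply_symm_apply
  let e : Coinduced A N J ≃ₛₗ[RingHomClass.toRingHom (swap A A N N)] Q :=
    { toFun := fun x => f'.symm x.1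
      invFun := fun q => Coinduced.mk (f q) 0
      map_add' := fun x y => by simp
      map_smul' := fun r x => hf.1 (by
        have h2 : x.2 r.n = 0 := by rw [hJ x.2]; rfl
        rw [hf', map_smulₛₗ, hf', Coinduced.smul_fst, h2, add_zero]
        rfl)
      left_inv := fun x => Coinduced.ext (hf' _) (hJ _).symm
      right_inv := fun q => f'.symm_apply_apply q }
  exact Module.Injective.of_ringEquiv (swap A A N N) e

/-- This is the exact sequence `0 → (J, 0) → (J, Hom_A(N, J)) → (0, Hom_A(N, J)) → 0`, whose last two
terms are injective. -/
theorem hasInjectiveDimensionLE_one_of_fstHom (hN : BalancedMapsVanish A N)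
    [Module.Projective Aᵐᵒᵖ N] {J M : Type u} [AddCommGroup J] [Module A J] [Module.Injective A J]
    [AddCommGroup M] [Module Λ M] (f : M →ₛₗ[fstHom A A N N] J) (hf : Function.Bijective f) :
    HasInjectiveDimensionLE (ModuleCat.of Λ M) 1 := by
  let := Module.compHom (HomDual A N J) (sndHom A A N N)
  have hZ := HomDual.injective (A := A) (N := N) (J := J)
  let i : M →ₗ[Λ] Coinduced A N J :=
    { toFun := fun x => Coinduced.mk (f x) 0
      map_add' := fun x y => by ext <;> simp
      map_smul' := fun r x => by ext <;> simp }
  let p : Coinduced A N J →ₗ[Λ] HomDual A N J :=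
    { toFun := fun x => x.2
      map_add' := fun x y => rfl
      map_smul' := fun r x => rfl }
  let q : HomDual A N J →ₛₗ[sndHom A A N N] HomDual A N J :=
    { toFun := id
      map_add' := fun x y => rfl
      map_smul' := fun r x => rfl }
  refine hasInjectiveDimensionLE_succ_of_exact i p
    (fun x y h => hf.1 (congrArg Prod.fst h)) (fun x => ⟨fun h => ?_, ?_⟩)
    (fun φ => ⟨Coinduced.mk 0 φ, rfl⟩)
    ((Coinduced.injective J).hasInjectiveDimensionLE 1)
    ((injective_of_sndHom (HomDual.eq_zero_of_balancedMapsVanish hN) q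
      Function.bijective_id).hasInjectiveDimensionLE 0)
  · obtain ⟨y, hy⟩ := hf.2 x.1
    exact ⟨y, Coinduced.ext hy (Eq.symm h)⟩
  · rintro ⟨y, rfl⟩
    rfl

/-- Inflation along the first projection raises the injective dimension by at most one. The
`Λ`-module `(X, 0)` is presented as any `M` with a semilinear bijection to `X`. -/
theorem hasInjectiveDimensionLE_of_fstHom (hN : BalancedMapsVanish A N)
    [Module.Projective Aᵐᵒᵖ N] {n : ℕ} {X M : Type u} [AddCommGroup X] [Module A X]
    (hX : HasInjectiveDimensionLE (ModuleCat.of A X) n)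
    [AddCommGroup M] [Module Λ M] (f : M →ₛₗ[fstHom A A N N] X) (hf : Function.Bijective f) :
    HasInjectiveDimensionLE (ModuleCat.of Λ M) (n + 1) := by
  induction n generalizing X M with
  | zero =>
    have := injective_iff_hasInjectiveDimensionLT_one.2 hX
    have := Module.injective_module_of_injective_object A X
    exact hasInjectiveDimensionLE_one_of_fstHom hN f hf
  | succ n ih =>
    obtain ⟨J, hJ, i, hi⟩ := EnoughInjectives.presentation (ModuleCat.of A X)
    have hJ' := Module.injective_module_of_injective_object A J
    have hi' : Function.Injective i.hom := (ModuleCat.mono_iff_injective i).1 hi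
    have hS := ModuleCat.shortComplex_shortExact
      (ModuleCat.shortComplexOfCompEqZero _ _ i.hom.exact_map_mkQ_range.linearMap_comp_eq_zero)
      i.hom.exact_map_mkQ_range hi' (Submodule.mkQ_surjective _)
    have hC := (hS.hasInjectiveDimensionLT_X₃_iff n hJ).2 hX
    let := Module.compHom J (fstHom A A N N)
    let C := J ⧸ LinearMap.range i.hom
    let := Module.compHom C (fstHom A A N N)
    have hMC := ih hC (M := C)
      { toFun := id, map_add' := fun x y => rfl, map_smul' := fun r x => rfl }
      Function.bijective_id
    have hMJ : HasInjectiveDimensionLE (ModuleCat.of Λ J) 1 :=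
      hasInjectiveDimensionLE_one_of_fstHom hN (J := J)
      { toFun := id, map_add' := fun x y => rfl, map_smul' := fun r x => rfl }
      Function.bijective_id
    let i' : M →ₗ[Λ] J :=
      { toFun := fun x => i.hom (f x)
        map_add' := fun x y => by simp
        map_smul' := fun r x => by
          rw [map_smulₛₗ, map_smul]; rfl }
    let p' : J →ₗ[Λ] C :=
      { toFun := Submodule.Quotient.mk
        map_add' := fun x y => rfl
        map_smul' := fun r x => rfl }
    have hex : Function.Exact i' p' := fun y => by
      refine (i.hom.exact_map_mkQ_range y).trans ⟨?_, ?_⟩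
      · rintro ⟨x, rfl⟩
        obtain ⟨z, rfl⟩ := hf.2 x
        exact ⟨z, rfl⟩
      · rintro ⟨z, rfl⟩
        exact ⟨f z, rfl⟩
    exact hasInjectiveDimensionLE_succ_of_exact i' p' (hi'.comp hf.1) hex
      (Submodule.Quotient.mk_surjective _) (hasInjectiveDimensionLT_of_ge _ 2 _ (by omega)) hMC

theorem hasInjectiveDimensionLE_of_sndHom (hN : BalancedMapsVanish A N)
    [Module.Projective Aᵐᵒᵖ N] {n : ℕ} {X M : Type u} [AddCommGroup X] [Module A X]
    (hX : HasInjectiveDimensionLE (ModuleCat.of A X) n)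
    [AddCommGroup M] [Module Λ M] (f : M →ₛₗ[sndHom A A N N] X) (hf : Function.Bijective f) :
    HasInjectiveDimensionLE (ModuleCat.of Λ M) (n + 1) := by
  let := Module.compHom X (fstHom A A N N)
  have h := hasInjectiveDimensionLE_of_fstHom hN hX (M := X)
    { toFun := id, map_add' := fun x y => rfl, map_smul' := fun r x => rfl }
    Function.bijective_id
  let e : M ≃ₛₗ[RingHomClass.toRingHom (swap A A N N)] X :=
    { toFun := f
      invFun := (Equiv.ofBijective f hf).symm
      map_add' := map_add f
      map_smul' := fun r x => map_smulₛₗ f r x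
      left_inv := (Equiv.ofBijective f hf).left_inv
      right_inv := (Equiv.ofBijective f hf).right_inv }
  exact (ModuleCat.hasInjectiveDimensionLE_iff_of_semiLinearEquiv (M := ModuleCat.of Λ M)
    (N := ModuleCat.of Λ X) (swap A A N N) e (n + 1)).2 h

end ZeroMoritaRing

/-! ### Finiteness of dimensions -/

theorem exists_nat_lt_of_lt_top {d : WithBot ℕ∞} (h : d < ⊤) : ∃ n : ℕ, d < n := by
  induction d with
  | bot => exact ⟨0, WithBot.bot_lt_coe _⟩
  | coe d =>
    induction d with
    | top => exact absurd h (lt_irrefl _)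
    | coe d => exact ⟨d + 1, by exact_mod_cast Nat.lt_succ_self d⟩

/-- Global dimension is detected by injective dimensions just as by projective ones, both being
expressed by the vanishing of `Ext`. -/
theorem leftGlobalDimension_lt_top_iff (R : Type u) [Ring R] :
    leftGlobalDimension R < ⊤ ↔ ∃ n : ℕ, ∀ (X : Type u) [AddCommGroup X] [Module R X],
      HasInjectiveDimensionLE (ModuleCat.of R X) n := by
  constructor
  · intro h
    obtain ⟨n, hn⟩ := exists_nat_lt_of_lt_top h
    refine ⟨n, fun X _ _ => (hasInjectiveDimensionLT_iff _ _).2 fun i hi Y e => ?_⟩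
    have := projectiveDimension_lt_iff.1 ((le_iSup projectiveDimension Y).trans_lt hn)
    exact e.eq_zero_of_hasProjectiveDimensionLT n (by omega)
  · rintro ⟨n, hn⟩
    refine lt_of_le_of_lt (iSup_le fun X => ?_)
      (WithBot.coe_lt_coe.2 (ENat.natCast_lt_top n))
    refine (projectiveDimension_le_iff X n).2
      ((hasProjectiveDimensionLT_iff _ _).2 fun i hi Y e => ?_)
    have := hn Y
    exact Abelian.Ext.eq_zero_of_hasInjectiveDimensionLT (X := Y) e (n + 1) hi

theorem injectiveDimension_lt_top_iff {R M : Type u} [Ring R] [AddCommGroup M] [Module R M] :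
    injectiveDimension (ModuleCat.of R M) < ⊤ ↔
      ∃ n, HasInjectiveDimensionLE (ModuleCat.of R M) n := by
  rw [lt_top_iff_ne_top, injectiveDimension_ne_top_iff]

namespace ZeroMoritaRing

section Finiteness

variable {A N : Type u} [Ring A] [AddCommGroup N] [Module A N] [Module Aᵐᵒᵖ N]
  [SMulCommClass A Aᵐᵒᵖ N]
variable (R : Type w) [CommRing R] [Algebra R (ZeroMoritaRing A A N N)]

/-- Scalars commute with the idempotent `(1 0; 0 0)`, so their off-diagonal entries vanish. -/
theorem algebraMap_n (r : R) : (algebraMap R (ZeroMoritaRing A A N N) r).n = 0 := by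
  have h := congrArg n (Algebra.commutes r (⟨1, 0, 0, 0⟩ : ZeroMoritaRing A A N N))
  simpa using h.symm

theorem smul_n (r : R) (x : ZeroMoritaRing A A N N) :
    (r • x).n = (algebraMap R (ZeroMoritaRing A A N N) r).a • x.n := by
  simp [Algebra.smul_def, algebraMap_n]

theorem smul_n_right (r : R) (x : ZeroMoritaRing A A N N) :
    (r • x).n = op (algebraMap R (ZeroMoritaRing A A N N) r).b • x.n := by
  simp [Algebra.smul_def, Algebra.commutes, algebraMap_n]

/-- If `R` acts on `N ⊆ Λ` through `S`, then generators of `Λ` over `R` give generators of `N`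
over `S`. -/
theorem finite_of_smul_n {S : Type*} [Ring S] [Module S N]
    [Module.Finite R (ZeroMoritaRing A A N N)] (c : R → S)
    (hc : ∀ r (x : ZeroMoritaRing A A N N), (r • x).n = c r • x.n) : Module.Finite S N := by
  obtain ⟨k, s, hs⟩ := Module.Finite.exists_fin (R := R) (M := ZeroMoritaRing A A N N)
  refine Module.Finite.of_surjective (Fintype.linearCombination S fun i => (s i).n) fun y => ?_
  have hy : ∀ x : ZeroMoritaRing A A N N, x.n ∈ Submodule.span S (Set.range fun i => (s i).n) := by
    intro x
    have hx : x ∈ Submodule.span R (Set.range s) := hs ▸ Submodule.mem_top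
    induction hx using Submodule.span_induction with
    | mem x hx =>
      obtain ⟨i, rfl⟩ := hx
      exact Submodule.subset_span ⟨i, rfl⟩
    | zero => exact Submodule.zero_mem _
    | add x y _ _ hx hy => exact Submodule.add_mem _ hx hy
    | smul r x _ hx =>
      rw [hc]
      exact Submodule.smul_mem _ _ hx
  have := hy ⟨0, y, 0, 0⟩
  rwa [← Fintype.range_linearCombination] at this

end Finiteness

/-! ### The regular module and arbitrary modules -/

variable {A N : Type u} [Ring A] [AddCommGroup N] [Module A N] [Module Aᵐᵒᵖ N]
  [SMulCommClass A Aᵐᵒᵖ N]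

local notation "Λ" => ZeroMoritaRing A A N N

theorem hasInjectiveDimensionLE_of_fstHom_surjective (hN : BalancedMapsVanish A N)
    [Module.Projective Aᵐᵒᵖ N] {n : ℕ} {X M : Type u} [AddCommGroup X] [Module A X]
    (hX : HasInjectiveDimensionLE (ModuleCat.of A X) n) [AddCommGroup M] [Module Λ M]
    (g : M →ₛₗ[fstHom A A N N] X) (hg : Function.Surjective g)
    (h : HasInjectiveDimensionLE (ModuleCat.of Λ (LinearMap.ker g)) (n + 1)) :
    HasInjectiveDimensionLE (ModuleCat.of Λ M) (n + 1) := by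
  let := Module.compHom X (fstHom A A N N)
  let g' : M →ₗ[Λ] X :=
    { toFun := g, map_add' := map_add g, map_smul' := fun r x => map_smulₛₗ g r x }
  exact hasInjectiveDimensionLE_of_surjective g' hg h
    (hasInjectiveDimensionLE_of_fstHom hN hX (M := X)
      { toFun := id, map_add' := fun _ _ => rfl, map_smul' := fun _ _ => rfl }
      Function.bijective_id)

theorem hasInjectiveDimensionLE_of_sndHom_surjective (hN : BalancedMapsVanish A N)
    [Module.Projective Aᵐᵒᵖ N] {n : ℕ} {X M : Type u} [AddCommGroup X] [Module A X]
    (hX : HasInjectiveDimensionLE (ModuleCat.of A X) n) [AddCommGroup M] [Module Λ M]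
    (g : M →ₛₗ[sndHom A A N N] X) (hg : Function.Surjective g)
    (h : HasInjectiveDimensionLE (ModuleCat.of Λ (LinearMap.ker g)) (n + 1)) :
    HasInjectiveDimensionLE (ModuleCat.of Λ M) (n + 1) := by
  let := Module.compHom X (sndHom A A N N)
  let g' : M →ₗ[Λ] X :=
    { toFun := g, map_add' := map_add g, map_smul' := fun r x => map_smulₛₗ g r x }
  exact hasInjectiveDimensionLE_of_surjective g' hg h
    (hasInjectiveDimensionLE_of_sndHom hN hX (M := X)
      { toFun := id, map_add' := fun _ _ => rfl, map_smul' := fun _ _ => rfl }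
      Function.bijective_id)

/-- The regular module is filtered by left ideals with layers `A`, `A`, `N` and `N`. -/
theorem hasInjectiveDimensionLE_self (hN : BalancedMapsVanish A N) [Module.Projective A N]
    [Module.Projective Aᵐᵒᵖ N] [Module.Finite A N] {n : ℕ}
    (h : HasInjectiveDimensionLE (ModuleCat.of A A) n) :
    HasInjectiveDimensionLE (ModuleCat.of Λ Λ) (n + 1) := by
  have hN' : HasInjectiveDimensionLE (ModuleCat.of A N) n :=
    hasInjectiveDimensionLE_of_finite_projective h
  let g₁ : Λ →ₛₗ[fstHom A A N N] A :=
    { toFun := fun x => x.a, map_add' := fun _ _ => rfl, map_smul' := fun _ _ => rfl }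
  have hg₁ : ∀ x : LinearMap.ker g₁, x.1.a = 0 := fun x => x.2
  let g₂ : LinearMap.ker g₁ →ₛₗ[sndHom A A N N] A :=
    { toFun := fun x => x.1.b, map_add' := fun _ _ => rfl, map_smul' := fun _ _ => rfl }
  have hg₂ : ∀ x : LinearMap.ker g₂, x.1.1.b = 0 := fun x => x.2
  let g₃ : LinearMap.ker g₂ →ₛₗ[fstHom A A N N] N :=
    { toFun := fun x => x.1.1.n
      map_add' := fun _ _ => rfl
      map_smul' := fun r x => by simp [hg₂ x] }
  have hg₃ : ∀ x : LinearMap.ker g₃, x.1.1.1.n = 0 := fun x => x.2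
  let g₄ : LinearMap.ker g₃ →ₛₗ[sndHom A A N N] N :=
    { toFun := fun x => x.1.1.1.m
      map_add' := fun _ _ => rfl
      map_smul' := fun r x => by simp [hg₁ x.1.1] }
  refine hasInjectiveDimensionLE_of_fstHom_surjective hN h g₁ (fun a => ⟨⟨a, 0, 0, 0⟩, rfl⟩) ?_
  refine hasInjectiveDimensionLE_of_sndHom_surjective hN h g₂
    (fun b => ⟨⟨⟨0, 0, 0, b⟩, rfl⟩, rfl⟩) ?_
  refine hasInjectiveDimensionLE_of_fstHom_surjective hN hN' g₃
    (fun y => ⟨⟨⟨⟨0, y, 0, 0⟩, rfl⟩, rfl⟩, rfl⟩) ?_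
  refine hasInjectiveDimensionLE_of_sndHom hN hN' g₄
    ⟨fun x y hxy => ?_, fun y => ⟨⟨⟨⟨⟨0, 0, y, 0⟩, rfl⟩, rfl⟩, rfl⟩, rfl⟩⟩
  ext
  · rw [hg₁, hg₁]
  · rw [hg₃, hg₃]
  · exact hxy
  · rw [hg₂, hg₂]

/-- The diagonal makes `M` an `A`-module. Since matrices with `a = 0` annihilate `M`, the action of
`Λ` is the one inflated along the first projection. -/
theorem hasInjectiveDimensionLE_of_fst_eq_zero (hN : BalancedMapsVanish A N)
    [Module.Projective Aᵐᵒᵖ N] {n : ℕ} (h : ∀ (X : Type u) [AddCommGroup X] [Module A X],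
      HasInjectiveDimensionLE (ModuleCat.of A X) n)
    (M : Type u) [AddCommGroup M] [Module Λ M] (hM : ∀ r : Λ, r.a = 0 → ∀ x : M, r • x = 0) :
    HasInjectiveDimensionLE (ModuleCat.of Λ M) (n + 1) := by
  let := Module.compHom M (diagHom A N)
  refine hasInjectiveDimensionLE_of_fstHom hN (h M)
    { toFun := id
      map_add' := fun x y => rfl
      map_smul' := fun r x => ?_ } Function.bijective_id
  change r • x = (⟨r.a, 0, 0, r.a⟩ : Λ) • x
  rw [← sub_eq_zero, ← sub_smul]
  exact hM _ (by simp [sub_eq_add_neg]) x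

theorem hasInjectiveDimensionLE_of_snd_eq_zero (hN : BalancedMapsVanish A N)
    [Module.Projective Aᵐᵒᵖ N] {n : ℕ} (h : ∀ (X : Type u) [AddCommGroup X] [Module A X],
      HasInjectiveDimensionLE (ModuleCat.of A X) n)
    (M : Type u) [AddCommGroup M] [Module Λ M] (hM : ∀ r : Λ, r.b = 0 → ∀ x : M, r • x = 0) :
    HasInjectiveDimensionLE (ModuleCat.of Λ M) (n + 1) := by
  let := Module.compHom M (diagHom A N)
  refine hasInjectiveDimensionLE_of_sndHom hN (h M)
    { toFun := id
      map_add' := fun x y => rfl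
      map_smul' := fun r x => ?_ } Function.bijective_id
  change r • x = (⟨r.b, 0, 0, r.b⟩ : Λ) • x
  rw [← sub_eq_zero, ← sub_smul]
  exact hM _ (by simp [sub_eq_add_neg]) x

/-- With `e = (0 0; 0 1)` and `J = (0 N; 0 0)`, the layers of the filtration `0 ⊆ J M ⊆ Λ e M ⊆ M`
are modules over one of the two diagonal copies of `A`. -/
theorem hasInjectiveDimensionLE_of_forall (hN : BalancedMapsVanish A N)
    [Module.Projective Aᵐᵒᵖ N] {n : ℕ} (h : ∀ (X : Type u) [AddCommGroup X] [Module A X],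
      HasInjectiveDimensionLE (ModuleCat.of A X) n)
    (M : Type u) [AddCommGroup M] [Module Λ M] :
    HasInjectiveDimensionLE (ModuleCat.of Λ M) (n + 1) := by
  let P : Submodule Λ M := Submodule.span Λ (Set.range fun x : M => (⟨0, 0, 0, 1⟩ : Λ) • x)
  let T : Submodule Λ M := Submodule.span Λ
    (Set.range fun y : N × M => (⟨0, y.1, 0, 0⟩ : Λ) • y.2)
  have hP : ∀ x : M, (⟨0, 0, 0, 1⟩ : Λ) • x ∈ P := fun x => Submodule.subset_span ⟨x, rfl⟩
  have hT : ∀ (y : N) (x : M), (⟨0, y, 0, 0⟩ : Λ) • x ∈ T :=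
    fun y x => Submodule.subset_span ⟨(y, x), rfl⟩
  have hMP : ∀ r : Λ, r.a = 0 → ∀ x : M, r • x ∈ P := fun r hr x => by
    have : r = (⟨0, r.n, 0, 0⟩ : Λ) * ⟨0, 0, 0, 1⟩ + ⟨0, 0, 0, 1⟩ * r := by
      ext <;> simp [hr]
    rw [this, add_smul, mul_smul, mul_smul]
    exact P.add_mem (P.smul_mem _ (hP x)) (hP _)
  have hPT : ∀ x ∈ P, ∀ r : Λ, r.b = 0 → r • x ∈ T := by
    intro x hx
    induction hx using Submodule.span_induction with
    | mem x hx =>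
      obtain ⟨x, rfl⟩ := hx
      intro r hr
      have : r * ⟨0, 0, 0, 1⟩ = (⟨0, r.n, 0, 0⟩ : Λ) := by ext <;> simp [hr]
      dsimp only
      rw [← mul_smul, this]
      exact hT _ _
    | zero => intro r _; simp
    | add x y _ _ hx hy =>
      intro r hr
      rw [smul_add]
      exact T.add_mem (hx r hr) (hy r hr)
    | smul s x _ hx =>
      intro r hr
      rw [← mul_smul]
      exact hx _ (by simp [hr])
  have hT0 : ∀ x ∈ T, ∀ r : Λ, r.a = 0 → r • x = 0 := by
    intro x hx
    induction hx using Submodule.span_induction with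
    | mem x hx =>
      obtain ⟨⟨y, x⟩, rfl⟩ := hx
      intro r hr
      have : r * ⟨0, y, 0, 0⟩ = 0 := by ext <;> simp [hr]
      dsimp only
      rw [← mul_smul, this, zero_smul]
    | zero => intro r _; simp
    | add x y _ _ hx hy =>
      intro r hr
      rw [smul_add, hx r hr, hy r hr, add_zero]
    | smul s x _ hx =>
      intro r hr
      rw [← mul_smul]
      exact hx _ (by simp [hr])
  refine hasInjectiveDimensionLE_of_submodule P
    (hasInjectiveDimensionLE_of_submodule (T.comap P.subtype) ?_ ?_) ?_
  · refine hasInjectiveDimensionLE_of_fst_eq_zero hN h _ fun r hr x => ?_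
    ext
    exact hT0 x.1.1 x.2 r hr
  · refine hasInjectiveDimensionLE_of_snd_eq_zero hN h _ fun r hr x => ?_
    obtain ⟨x, rfl⟩ := Submodule.Quotient.mk_surjective _ x
    rw [← Submodule.Quotient.mk_smul, Submodule.Quotient.mk_eq_zero]
    exact hPT x.1 x.2 r hr
  · refine hasInjectiveDimensionLE_of_fst_eq_zero hN h _ fun r hr x => ?_
    obtain ⟨x, rfl⟩ := Submodule.Quotient.mk_surjective _ x
    rw [← Submodule.Quotient.mk_smul, Submodule.Quotient.mk_eq_zero]
    exact hMP r hr x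

end ZeroMoritaRing

/-! ### The opposite ring -/

section Opposite

/-- An `A`-`A`-bimodule is an `Aᵐᵒᵖ`-`Aᵐᵒᵖ`-bimodule; this is its right `Aᵐᵒᵖ`-action. -/
abbrev Module.opOp (A N : Type*) [Ring A] [AddCommGroup N] [Module A N] : Module Aᵐᵒᵖᵐᵒᵖ N :=
  Module.compHom N (RingEquiv.opOp A).symm.toRingHom

attribute [local instance] Module.opOp

theorem opOp_smul {A N : Type u} [Ring A] [AddCommGroup N] [Module A N]
    (a : Aᵐᵒᵖᵐᵒᵖ) (x : N) : a • x = a.unop.unop • x := rfl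

theorem opOp_smulCommClass {A N : Type u} [Ring A] [AddCommGroup N] [Module A N]
    [Module Aᵐᵒᵖ N] [SMulCommClass A Aᵐᵒᵖ N] : SMulCommClass Aᵐᵒᵖ Aᵐᵒᵖᵐᵒᵖ N :=
  ⟨fun a b x => (smul_comm b.unop.unop a x).symm⟩

attribute [local instance] opOp_smulCommClass

theorem opOp_projective {A N : Type u} [Ring A] [AddCommGroup N] [Module A N]
    [Module.Projective A N] : Module.Projective Aᵐᵒᵖᵐᵒᵖ N := by
  let := RingHomInvPair.of_ringEquiv (RingEquiv.opOp A)
  let := RingHomInvPair.of_ringEquiv (RingEquiv.opOp A).symm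
  let e : N ≃ₛₗ[RingHomClass.toRingHom (RingEquiv.opOp A)] N :=
    { AddEquiv.refl N with map_smul' := fun _ _ => rfl }
  exact Module.Projective.of_equiv e

theorem BalancedMapsVanish.op {A N : Type u} [Ring A] [AddCommGroup N] [Module A N]
    [Module Aᵐᵒᵖ N] (hN : BalancedMapsVanish A N) :
    BalancedMapsVanish Aᵐᵒᵖ N :=
  fun P _ β hβ x y => hN P β.flip (fun a x y => (hβ (MulOpposite.op a) y x).symm) y x

/-- Transposition identifies the opposite of the Morita ring of `N` with the Morita ring of `N`
regarded as an `Aᵐᵒᵖ`-`Aᵐᵒᵖ`-bimodule. -/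
def ZeroMoritaRing.opEquiv (A N : Type u) [Ring A] [AddCommGroup N] [Module A N] [Module Aᵐᵒᵖ N]
    [SMulCommClass A Aᵐᵒᵖ N] :
    ZeroMoritaRing Aᵐᵒᵖ Aᵐᵒᵖ N N ≃+* (ZeroMoritaRing A A N N)ᵐᵒᵖ where
  toFun r := op ⟨r.a.unop, r.m, r.n, r.b.unop⟩
  invFun r := ⟨op r.unop.a, r.unop.m, r.unop.n, op r.unop.b⟩
  left_inv _ := rfl
  right_inv _ := rfl
  map_mul' r s := by
    apply MulOpposite.unop_injective
    ext <;> simp [opOp_smul, add_comm]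
  map_add' _ _ := rfl

/-- A ring as a right module over itself is the regular left module of the opposite ring. -/
def opSelfEquiv (R : Type*) [Ring R] : R ≃ₗ[Rᵐᵒᵖ] Rᵐᵒᵖ :=
  { opAddEquiv with map_smul' := fun _ _ => rfl }

theorem ZeroMoritaRing.hasInjectiveDimensionLE_op_self
    {A N : Type u} [Ring A] [AddCommGroup N] [Module A N]
    [Module Aᵐᵒᵖ N] [SMulCommClass A Aᵐᵒᵖ N] (hN : BalancedMapsVanish A N)
    [Module.Projective A N] [Module.Projective Aᵐᵒᵖ N] [Module.Finite Aᵐᵒᵖ N] {n : ℕ}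
    (h : HasInjectiveDimensionLE (ModuleCat.of Aᵐᵒᵖ A) n) :
    HasInjectiveDimensionLE
      (ModuleCat.of (ZeroMoritaRing A A N N)ᵐᵒᵖ (ZeroMoritaRing A A N N)) (n + 1) := by
  have := opOp_projective (A := A) (N := N)
  have h' := hasInjectiveDimensionLE_self hN.op
    ((ModuleCat.hasInjectiveDimensionLE_iff_of_linearEquiv (M := ModuleCat.of Aᵐᵒᵖ A)
      (N := ModuleCat.of Aᵐᵒᵖ Aᵐᵒᵖ) (opSelfEquiv A) n).1 h)
  let := RingHomInvPair.of_ringEquiv (opEquiv A N)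
  let := RingHomInvPair.of_ringEquiv (opEquiv A N).symm
  let e : ZeroMoritaRing Aᵐᵒᵖ Aᵐᵒᵖ N N ≃ₛₗ[RingHomClass.toRingHom (opEquiv A N)]
      ZeroMoritaRing A A N N :=
    { ((opEquiv A N).toAddEquiv.trans opAddEquiv.symm) with
      map_smul' := fun r x => congrArg unop (map_mul (opEquiv A N) r x) }
  exact (ModuleCat.hasInjectiveDimensionLE_iff_of_semiLinearEquiv
    (M := ModuleCat.of (ZeroMoritaRing Aᵐᵒᵖ Aᵐᵒᵖ N N) (ZeroMoritaRing Aᵐᵒᵖ Aᵐᵒᵖ N N))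
    (N := ModuleCat.of (ZeroMoritaRing A A N N)ᵐᵒᵖ (ZeroMoritaRing A A N N))
    (opEquiv A N) e (n + 1)).1 h'

end Opposite

theorem corollary4p11 {A N : Type u} [Ring A] [AddCommGroup N]
    -- `N` is an `A`-`A`-bimodule
    [Module A N] [Module Aᵐᵒᵖ N] [SMulCommClass A Aᵐᵒᵖ N]
    -- the Morita ring is an Artin algebra, over some commutative artinian ring `R`
    (R : Type w) [CommRing R] [IsArtinianRing R] [Algebra R (ZeroMoritaRing A A N N)]
    [Module.Finite R (ZeroMoritaRing A A N N)]
    (hleft : Module.Projective A N) (hright : Module.Projective Aᵐᵒᵖ N)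
    (hN : Subsingleton (BalancedTensor A N N)) :
    (IsGorensteinRing A → IsGorensteinRing (ZeroMoritaRing A A N N)) ∧
      (leftGlobalDimension A < ⊤ → leftGlobalDimension (ZeroMoritaRing A A N N) < ⊤) := by
  have hN' := balancedMapsVanish_of_subsingleton hN
  have hfl : Module.Finite A N :=
    ZeroMoritaRing.finite_of_smul_n R _ (ZeroMoritaRing.smul_n R)
  have hfr : Module.Finite Aᵐᵒᵖ N :=
    ZeroMoritaRing.finite_of_smul_n R _ (ZeroMoritaRing.smul_n_right R)
  constructor
  · rintro ⟨hl, hr⟩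
    obtain ⟨l, hl⟩ := injectiveDimension_lt_top_iff.1 hl
    obtain ⟨r, hr⟩ := injectiveDimension_lt_top_iff.1 hr
    exact ⟨injectiveDimension_lt_top_iff.2
        ⟨l + 1, ZeroMoritaRing.hasInjectiveDimensionLE_self hN' hl⟩,
      injectiveDimension_lt_top_iff.2
        ⟨r + 1, ZeroMoritaRing.hasInjectiveDimensionLE_op_self hN' hr⟩⟩
  · rw [leftGlobalDimension_lt_top_iff, leftGlobalDimension_lt_top_iff]
    rintro ⟨n, h⟩
    exact ⟨n + 1, fun M _ _ => ZeroMoritaRing.hasInjectiveDimensionLE_of_forall hN' h M⟩
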